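/- Let $K$ be an algebraically closed field and let $n\ge 1$. For tensors $S\in K^{a',b',c'}$ and $T\in K^{a,b,c}$ write $S\le T$ if there are matrices $A\in\mathrm{Mat}_{a',a}(K)$, $B\in\mathrm{Mat}_{b',b}(K)$, $C\in\mathrm{Mat}_{c',c}(K)$ with $S=(A\otimes B\otimes C)T$, that is, $S_{i,j,k}=\sum_{p,q,s}A_{i,p}B_{j,q}C_{k,s}T_{p,q,s}$ for all $i,j,k$. Let $I_r\in K^{r,r,r}$ be the tensor with entries $1$ at the positions $(i,i,i)$ and $0$ elsewhere, and let the subrank $\mathrm{Q}(T)$ be the largest $r\ge 0$ such that $I_r\le T$. Then: 1. There is exactly one integer $\mathrm{Q}(n)$, called the generic subrank, such that all tensors in some nonempty Zariski-open subset of $K^{n,n,n}$ have subrank $\mathrm{Q}(n)$, and it satisfies $$\mathrm{Q}(n)\le\lfloor\sqrt{3n-2}\rfloor .$$ 2. For $r\ge 0$ let $\mathcal{C}_r=\{T\in K^{n,n,n} : \mathrm{Q}(T)\ge r\}$. For $0\le r\le n$ let $X_r$ be the set of all $T\in K^{n,n,n}$ such that $T_{i,j,k}=0$ for all $i,j,k\le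 r$ that are not all equal, and $T_{i,i,i}\ne 0$ for all $i\le r$. Then for $0\le r\le n$, $$\mathcal{C}_r=\{(A\otimes B\otimes C)T : A,B,C\in\mathrm{GL}_n(K),\ T\in X_r\}.$$ 3. For every $r\ge 0$, $$\dim\mathcal{C}_r\le n^3-r(r^2-3n+2),$$ where $\dim$ is the dimension of the Zariski closure and $\dim\emptyset=-\infty$. -/

import Mathlib

/-- The space `K^{a,b,c}` of `3`-tensors (three-dimensional arrays) of format `a × b × c`. -/
abbrev Tensor3 (K : Type*) (a b c : ℕ) : Type _ := Fin a × Fin b × Fin c → K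

namespace Tensor3

variable {K : Type*} [Field K]

/-- `(A ⊗ B ⊗ C) T`: the tensor obtained by applying the matrices `A`, `B`, `C` to the three
legs of `T`. -/
def act {a b c a' b' c' : ℕ} (A : Matrix (Fin a') (Fin a) K) (B : Matrix (Fin b') (Fin b) K)
    (C : Matrix (Fin c') (Fin c) K) (T : Tensor3 K a b c) : Tensor3 K a' b' c' :=
  fun x => ∑ i, ∑ j, ∑ k, A x.1 i * B x.2.1 j * C x.2.2 k * T (i, j, k)

/-- `S ≤ T`: the tensor `S` is a restriction of `T`. -/
def Restricts {a b c a' b' c' : ℕ} (S : Tensor3 K a' b' c') (T : Tensor3 K a b c) : Prop :=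
  ∃ (A : Matrix (Fin a') (Fin a) K) (B : Matrix (Fin b') (Fin b) K)
    (C : Matrix (Fin c') (Fin c) K), S = act A B C T

/-- The unit tensor `I_r ∈ K^{r,r,r}`: ones at the positions `(i,i,i)`, zeros elsewhere. -/
def unit (K : Type*) [Field K] (r : ℕ) : Tensor3 K r r r :=
  fun x => if x.1 = x.2.1 ∧ x.2.1 = x.2.2 then 1 else 0

/-- The subrank `Q(T)`: the largest `r` with `I_r ≤ T` (see `isGreatest_subrank`). -/
noncomputable def subrank {a b c : ℕ} (T : Tensor3 K a b c) : ℕ :=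
  sSup {r : ℕ | Restricts (unit K r) T}

theorem le_of_unit_restricts {a b c r : ℕ} {T : Tensor3 K a b c}
    (h : Restricts (unit K r) T) : r ≤ a := by
  obtain ⟨A, B, C, h⟩ := h
  have hli : LinearIndependent K (fun i : Fin r => A i) := by
    rw [Fintype.linearIndependent_iff]
    intro g hg l
    have h1 : ∑ i, g i * unit K r (i, l, l) = g l := by
      simp [unit]
    rw [← h1, h]
    have h2 : ∀ p, ∑ i, g i * A i p = 0 := fun p => by
      simpa using congrFun hg p
    simp only [act, Finset.mul_sum]
    rw [Finset.sum_comm]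
    refine Finset.sum_eq_zero fun p _ => ?_
    rw [Finset.sum_comm]
    refine Finset.sum_eq_zero fun q _ => ?_
    rw [Finset.sum_comm]
    refine Finset.sum_eq_zero fun s _ => ?_
    calc ∑ i, g i * (A i p * B l q * C l s * T (p, q, s))
        = (∑ i, g i * A i p) * (B l q * C l s * T (p, q, s)) := by
          rw [Finset.sum_mul]
          exact Finset.sum_congr rfl fun i _ => by ring
      _ = 0 := by rw [h2, zero_mul]
  simpa using hli.fintype_card_le_finrank

/-- The maximum in the definition of the subrank is attained. -/
theorem isGreatest_subrank {a b c : ℕ} (T : Tensor3 K a b c) :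
    IsGreatest {r : ℕ | Restricts (unit K r) T} (subrank T) := by
  have hb : BddAbove {r : ℕ | Restricts (unit K r) T} := ⟨a, fun _ hr => le_of_unit_restricts hr⟩
  have hne : {r : ℕ | Restricts (unit K r) T}.Nonempty :=
    ⟨0, 0, 0, 0, funext fun x => x.1.elim0⟩
  exact ⟨Nat.sSup_mem hne hb, fun _ hr => le_csSup hb hr⟩

/-- The set `C_r` of tensors in `K^{n,n,n}` of subrank at least `r`. -/
def subrankGE (K : Type*) [Field K] (n r : ℕ) : Set (Tensor3 K n n n) :=
  {T | r ≤ subrank T}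

/-- The set `X_r` of tensors in `K^{n,n,n}` (for `r ≤ n`) whose leading `r × r × r` subtensor is
zero off its diagonal and nonzero at every diagonal position. -/
def diagonalBlock (K : Type*) [Field K] (n r : ℕ) : Set (Tensor3 K n n n) :=
  {T | (∀ i j k : Fin n, i.val < r → j.val < r → k.val < r → ¬(i = j ∧ j = k) →
      T (i, j, k) = 0) ∧ ∀ i : Fin n, i.val < r → T (i, i, i) ≠ 0}

/-- The union of the orbits of the elements of `X` under the action of `GL_n × GL_n × GL_n`. -/
def orbit {n : ℕ} (X : Set (Tensor3 K n n n)) : Set (Tensor3 K n n n) :=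
  {S | ∃ A B C : Matrix.GeneralLinearGroup (Fin n) K, ∃ T ∈ X,
    S = act (A : Matrix (Fin n) (Fin n) K) (B : Matrix (Fin n) (Fin n) K)
      (C : Matrix (Fin n) (Fin n) K) T}

end Tensor3

/-- A subset of the affine space `K^σ` is Zariski-open if its complement is the set of common
zeros of finitely many polynomials. -/
def IsZariskiOpen {K σ : Type*} [Field K] (U : Set (σ → K)) : Prop :=
  ∃ F : Finset (MvPolynomial σ K), Uᶜ = {x | ∀ p ∈ F, MvPolynomial.eval x p = 0}

/-- The dimension of a constructible subset `S` of the affine space `K^σ` (`K` algebraically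
closed, `σ` finite), i.e. the dimension of its Zariski closure: the Krull dimension of the
coordinate ring `K[x_s : s ∈ σ] / I(S)`. It is `⊥` (that is, `-∞`) for `S = ∅`. -/
noncomputable def zariskiDim {K σ : Type*} [Field K] (S : Set (σ → K)) : WithBot ℕ∞ :=
  ringKrullDim (MvPolynomial σ K ⧸ MvPolynomial.vanishingIdeal K S)

/-- `r` is the generic subrank of tensors in `K^{n,n,n}`: all tensors in some nonempty
Zariski-open set have subrank `r`. -/
def IsGenericSubrank (K : Type*) [Field K] (n r : ℕ) : Prop :=
  ∃ U : Set (Tensor3 K n n n), IsZariskiOpen U ∧ U.Nonempty ∧ ∀ T ∈ U, Tensor3.subrank T = r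

/-! If `I_r = (A ⊗ B ⊗ C) T`, the rows of `A`, `B`, `C` are independent, so they complete to
invertible matrices that carry `T` into `X_r`; this gives the orbit description. For the dimension,
complete by standard basis vectors and scale each of the `r` given rows to have a 1 at a pivot. For
each of the finitely many pivot choices, `r(n-1)` entries per matrix stay free, and a tensor with
diagonal leading block has `n³ - r³ + r`; the sum is `n³ - r(r² - 3n + 2)`. So `C_r` is covered by
finitely many polynomial images of affine spaces of that dimension (`exists_eval_pivotPoly_eq`,
`zariskiDim_le_of_subset_iUnion_range`).

For the generic subrank, `C_r` is a projection of an affine variety, so by Chevalley it contains a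
nonempty open set once it is dense (`exists_ne_zero_subset_image_zeroLocus`). The largest `q` with
`C_q` dense is generic: remove from such an open set a hypersurface containing `C_{q+1}`. Density
forces `dim C_q = n³`, and the dimension bound then gives `q² + 2 ≤ 3n` when `q > 0`. -/

/-! ### Dimension and constructibility of images of polynomial maps. -/

section PolynomialMaps

open MvPolynomial

theorem ringKrullDim_le_of_isIntegral {R S : Type*} [CommRing R] [CommRing S] {f : R →+* S}
    (hf : f.IsIntegral) : ringKrullDim S ≤ ringKrullDim R := by
  refine Order.krullDim_le_of_strictMono (PrimeSpectrum.comap f) fun P Q hPQ => ?_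
  obtain ⟨x, hxQ, hxP⟩ := SetLike.exists_of_lt (show P.asIdeal < Q.asIdeal from hPQ)
  algebraize [f]
  have : Algebra.IsIntegral R S := ⟨hf⟩
  exact Ideal.comap_lt_comap_of_integral_mem_sdiff (R := R) (I := P.asIdeal) (J := Q.asIdeal)
    (le_of_lt hPQ) ⟨hxQ, hxP⟩ (Algebra.IsIntegral.isIntegral x)

/-- Noether normalization makes `R` integral over a polynomial ring in `s` variables; transcendence
degree bounds `s`. -/
theorem ringKrullDim_le_of_injective_mvPolynomial {K R τ : Type*} [Field K] [CommRing R]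
    [Algebra K R] [Algebra.FiniteType K R] [Fintype τ] (f : R →ₐ[K] MvPolynomial τ K)
    (hf : Function.Injective f) : ringKrullDim R ≤ (Fintype.card τ : WithBot ℕ∞) := by
  have : Nontrivial R := f.toRingHom.domain_nontrivial
  obtain ⟨s, g, hg, hint⟩ := exists_integral_inj_algHom_of_fg K R
  have hs : s ≤ Fintype.card τ := by
    have h := _root_.lift_trdeg_le_of_injective (f.comp g) (hf.comp hg)
    simpa [MvPolynomial.trdeg_of_isDomain] using h
  calc ringKrullDim R ≤ ringKrullDim (MvPolynomial (Fin s) K) := ringKrullDim_le_of_isIntegral hint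
    _ = (s : WithBot ℕ∞) := by
      rw [MvPolynomial.ringKrullDim_of_isNoetherianRing, ringKrullDim_eq_zero_of_field]; simp
    _ ≤ _ := by exact_mod_cast hs

theorem zariskiDim_le_of_subset_iUnion_range {K σ ι : Type*} [Field K] [Finite σ] [Finite ι]
    {τ : ι → Type*} [∀ i, Fintype (τ i)] {N : ℕ} (hN : ∀ i, Fintype.card (τ i) ≤ N)
    (F : ∀ i, σ → MvPolynomial (τ i) K) {S : Set (σ → K)}
    (hS : ∀ x ∈ S, ∃ i, ∃ y : τ i → K, ∀ s, eval y (F i s) = x s) :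
    zariskiDim S ≤ (N : WithBot ℕ∞) := by
  have := Fintype.ofFinite ι
  have hker : Finset.univ.inf (fun i => RingHom.ker (aeval (R := K) (F i))) ≤
      vanishingIdeal K S := by
    intro p hp x hx
    obtain ⟨i, y, hy⟩ := hS x hx
    have hpi : aeval (F i) p = 0 := by
      have : p ∈ RingHom.ker (aeval (R := K) (F i)) :=
        SetLike.le_def.1 (Finset.inf_le (Finset.mem_univ i)) hp
      exact this
    have h1 : x = fun s => aeval y (F i s) := funext fun s => (hy s).symm
    rw [h1, ← comp_aeval_apply, hpi, map_zero]
  rw [zariskiDim, ringKrullDim_quotient, Order.krullDim]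
  refine iSup_le fun l => ?_
  -- The smallest prime of the chain contains the intersection of the kernels, hence one of them, so
  -- the whole chain lives over a single parametrization.
  obtain ⟨i, -, hi⟩ := (Ideal.IsPrime.inf_le' (l.head.1.isPrime)).1 (hker.trans l.head.2)
  have hmem : ∀ j, (l j).1 ∈ PrimeSpectrum.zeroLocus
      (RingHom.ker (aeval (R := K) (F i)) : Set (MvPolynomial σ K)) := fun j =>
    le_trans hi (show l.head.1.asIdeal ≤ (l j).1.asIdeal from LTSeries.head_le l j)
  let l' : LTSeries (PrimeSpectrum.zeroLocus
      (RingHom.ker (aeval (R := K) (F i)) : Set (MvPolynomial σ K))) :=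
    { length := l.length
      toFun := fun j => ⟨(l j).1, hmem j⟩
      step := fun j => l.step j }
  have h1 : (l.length : WithBot ℕ∞) ≤
      ringKrullDim (MvPolynomial σ K ⧸ RingHom.ker (aeval (R := K) (F i))) := by
    rw [ringKrullDim_quotient]
    exact Order.LTSeries.length_le_krullDim l'
  refine h1.trans ((ringKrullDim_le_of_injective_mvPolynomial
    (Ideal.kerLiftAlg (aeval (R := K) (F i))) (Ideal.kerLiftAlg_injective _)).trans ?_)
  exact_mod_cast hN i

theorem zariskiDim_of_vanishingIdeal_eq_bot {K σ : Type*} [Field K] [Fintype σ] {S : Set (σ → K)}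
    (hS : vanishingIdeal K S = ⊥) : zariskiDim S = (Fintype.card σ : WithBot ℕ∞) := by
  rw [zariskiDim, hS, ringKrullDim_eq_of_ringEquiv (RingEquiv.quotientBot _),
    MvPolynomial.ringKrullDim_of_isNoetherianRing, ringKrullDim_eq_zero_of_field]
  simp

theorem vanishingIdeal_eq_bot_of_ne_zero_subset {K σ : Type*} [Field K] [Infinite K]
    {S : Set (σ → K)} {a : MvPolynomial σ K} (ha : a ≠ 0) (hS : {x | eval x a ≠ 0} ⊆ S) :
    vanishingIdeal K S = ⊥ := by
  rw [eq_bot_iff]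
  intro p hp
  have h : a * p = 0 := by
    refine MvPolynomial.funext fun x => ?_
    by_cases hx : eval x a = 0
    · simp [hx]
    · have : eval x p = 0 := hp x (hS hx)
      simp [this]
  exact (mul_eq_zero.1 h).resolve_left ha

theorem IsZariskiOpen.exists_ne_zero_subset {K σ : Type*} [Field K] {U : Set (σ → K)}
    (hU : IsZariskiOpen U) (hne : U.Nonempty) :
    ∃ a : MvPolynomial σ K, a ≠ 0 ∧ {x | eval x a ≠ 0} ⊆ U := by
  obtain ⟨F, hF⟩ := hU
  obtain ⟨x, hx⟩ := hne
  have : x ∉ {x | ∀ p ∈ F, eval x p = 0} := by rw [← hF]; simpa using hx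
  simp only [Set.mem_ofPred_eq, not_forall] at this
  obtain ⟨a, haF, hax⟩ := this
  refine ⟨a, fun h => hax (by simp [h]), fun y hy => ?_⟩
  by_contra hyU
  have : y ∈ {x | ∀ p ∈ F, eval x p = 0} := by rw [← hF]; exact hyU
  exact hy (this a haF)

theorem isZariskiOpen_ne_zero {K σ : Type*} [Field K] (a : MvPolynomial σ K) :
    IsZariskiOpen {x : σ → K | eval x a ≠ 0} :=
  ⟨{a}, by ext x; simp⟩

theorem Topology.IsConstructible.exists_basicOpen_subset {R : Type*} [CommRing R] [IsDomain R]
    {Z : Set (PrimeSpectrum R)} (hZ : Topology.IsConstructible Z) (h : ⟨⊥, Ideal.isPrime_bot⟩ ∈ Z) :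
    ∃ a : R, a ≠ 0 ∧ (PrimeSpectrum.basicOpen a : Set (PrimeSpectrum R)) ⊆ Z := by
  obtain ⟨D, rfl⟩ := PrimeSpectrum.exists_constructibleSetData_iff.2 hZ
  simp only [PrimeSpectrum.ConstructibleSetData.toSet, Set.mem_iUnion] at h
  obtain ⟨C, hC, hg, hf⟩ := h
  have hf' : C.f ≠ 0 := by simpa [PrimeSpectrum.mem_zeroLocus] using hf
  refine ⟨C.f, hf', fun P hP => Set.mem_biUnion hC ⟨?_, ?_⟩⟩
  · intro x hx
    have : x = 0 := hg hx
    rw [this]; exact P.asIdeal.zero_mem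
  · simpa [PrimeSpectrum.mem_zeroLocus] using hP

/-- The dense image of an affine variety under a polynomial map contains a nonempty principal open
set. -/
theorem exists_ne_zero_subset_image_zeroLocus {K σ τ : Type*} [Field K] [IsAlgClosed K]
    [Finite σ] [Finite τ] (J : Ideal (MvPolynomial τ K)) (F : σ → MvPolynomial τ K)
    (hF : vanishingIdeal K ((fun y s => eval y (F s)) '' zeroLocus K J) = ⊥) :
    ∃ a : MvPolynomial σ K, a ≠ 0 ∧
      {x | eval x a ≠ 0} ⊆ (fun y s => eval y (F s)) '' zeroLocus K J := by
  let φ : MvPolynomial σ K →ₐ[K] (MvPolynomial τ K ⧸ J) :=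
    (Ideal.Quotient.mkₐ K J).comp (aeval F)
  have hφ : Function.Injective φ := by
    rw [injective_iff_map_eq_zero]
    intro p hp
    have hp' : aeval F p ∈ J := Ideal.Quotient.eq_zero_iff_mem.1 hp
    have : p ∈ vanishingIdeal K ((fun y s => eval y (F s)) '' zeroLocus K J) := by
      rintro _ ⟨y, hy, rfl⟩
      have h := hy _ hp'
      rwa [comp_aeval_apply] at h
    rw [hF] at this
    exact this
  have hfp : φ.toRingHom.FinitePresentation := by
    rw [← RingHom.FinitePresentation.of_finiteType]
    refine RingHom.FiniteType.of_comp_finiteType (f := algebraMap K (MvPolynomial σ K)) ?_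
    have : φ.toRingHom.comp (algebraMap K (MvPolynomial σ K)) =
      algebraMap K (MvPolynomial τ K ⧸ J) := φ.comp_algebraMap
    rw [this, RingHom.finiteType_algebraMap]
    infer_instance
  -- Chevalley: the range is constructible. It contains the generic point because minimal primes
  -- lift along the injective `φ`.
  obtain ⟨a, ha, hsub⟩ := (PrimeSpectrum.isConstructible_range_comap hfp).exists_basicOpen_subset
    (by
      obtain ⟨Q, hQ, hc⟩ := Ideal.exists_comap_eq_of_mem_minimalPrimes_of_injective
        (f := φ.toRingHom) hφ ⊥ (by simp [IsDomain.minimalPrimes_eq_singleton_bot])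
      exact ⟨⟨Q, hQ⟩, PrimeSpectrum.ext hc⟩)
  refine ⟨a, ha, fun x hx => ?_⟩
  have hmax : (vanishingIdeal K {x} : Ideal (MvPolynomial σ K)).IsMaximal :=
    isMaximal_iff_eq_vanishingIdeal_singleton.2 ⟨x, rfl⟩
  obtain ⟨Q, hQ⟩ := hsub (show pointToPoint x ∈ PrimeSpectrum.basicOpen a from fun h => hx (by
    simpa [coe_aeval_eq_eval] using (mem_vanishingIdeal_singleton_iff x a).1 h))
  have hQ' : Q.asIdeal.comap φ.toRingHom = vanishingIdeal K {x} := congrArg PrimeSpectrum.asIdeal hQ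
  -- `Q` need not be a closed point. Enlarging it to a maximal ideal keeps the contraction, already
  -- maximal, and the Nullstellensatz turns `M` into a point `y`.
  obtain ⟨M, hM, hQM⟩ := Ideal.exists_le_maximal Q.asIdeal Q.isPrime.ne_top
  have hMx : M.comap φ.toRingHom = vanishingIdeal K {x} := by
    refine (hmax.eq_of_le (Ideal.comap_ne_top _ hM.ne_top) ?_).symm
    rw [← hQ']
    exact Ideal.comap_mono hQM
  have hM' : (M.comap (Ideal.Quotient.mk J)).IsMaximal :=
    Ideal.comap_isMaximal_of_surjective _ Ideal.Quotient.mk_surjective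
  obtain ⟨y, hy⟩ := isMaximal_iff_eq_vanishingIdeal_singleton.1 hM'
  refine ⟨y, fun p hp => ?_, funext fun s => ?_⟩
  · rw [← mem_vanishingIdeal_singleton_iff, ← hy, Ideal.mem_comap,
      Ideal.Quotient.eq_zero_iff_mem.2 hp]
    exact M.zero_mem
  · have h1 : X s - C (x s) ∈ M.comap φ.toRingHom := by
      rw [hMx, mem_vanishingIdeal_singleton_iff]
      simp
    have h2 : aeval F (X s - C (x s)) ∈ M.comap (Ideal.Quotient.mk J) := h1
    rw [hy, mem_vanishingIdeal_singleton_iff] at h2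
    simpa [sub_eq_zero, coe_aeval_eq_eval] using h2

end PolynomialMaps

/-! ### Restriction and the action of matrices. -/

namespace Tensor3

section Restriction

variable {K : Type*} [Field K]

theorem act_apply {a b c a' b' c' : ℕ} (A : Matrix (Fin a') (Fin a) K)
    (B : Matrix (Fin b') (Fin b) K) (C : Matrix (Fin c') (Fin c) K) (T : Tensor3 K a b c)
    (x : Fin a' × Fin b' × Fin c') :
    act A B C T x = ∑ y, A x.1 y.1 * B x.2.1 y.2.1 * C x.2.2 y.2.2 * T y := by
  simp only [act, Fintype.sum_prod_type]

theorem act_act {a b c a' b' c' a'' b'' c'' : ℕ} (A' : Matrix (Fin a'') (Fin a') K)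
    (B' : Matrix (Fin b'') (Fin b') K) (C' : Matrix (Fin c'') (Fin c') K)
    (A : Matrix (Fin a') (Fin a) K) (B : Matrix (Fin b') (Fin b) K)
    (C : Matrix (Fin c') (Fin c) K) (T : Tensor3 K a b c) :
    act A' B' C' (act A B C T) = act (A' * A) (B' * B) (C' * C) T := by
  funext x
  have h (z : Fin a × Fin b × Fin c) : (A' * A) x.1 z.1 * (B' * B) x.2.1 z.2.1 *
      (C' * C) x.2.2 z.2.2 = ∑ y : Fin a' × Fin b' × Fin c',
        A' x.1 y.1 * B' x.2.1 y.2.1 * C' x.2.2 y.2.2 *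
          (A y.1 z.1 * B y.2.1 z.2.1 * C y.2.2 z.2.2) := by
    simp only [Matrix.mul_apply, Fintype.sum_prod_type, Finset.sum_mul_sum]
    refine Finset.sum_congr rfl fun i _ => ?_
    simp only [Finset.sum_mul]
    rw [Finset.sum_comm]
    exact Finset.sum_congr rfl fun j _ => Finset.sum_congr rfl fun k _ => by ring
  simp only [act_apply, h, Finset.mul_sum, Finset.sum_mul]
  rw [Finset.sum_comm]
  exact Finset.sum_congr rfl fun z _ => Finset.sum_congr rfl fun y _ => by ring

theorem act_one {a b c : ℕ} (T : Tensor3 K a b c) : act 1 1 1 T = T := by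
  funext x
  simp [act, Matrix.one_apply, ite_mul]

theorem act_smul {a b c a' b' c' : ℕ} (A : Matrix (Fin a') (Fin a) K)
    (B : Matrix (Fin b') (Fin b) K) (C : Matrix (Fin c') (Fin c) K) (T : Tensor3 K a b c)
    (s t u : K) : act (s • A) (t • B) (u • C) T = act A B C ((s * t * u) • T) := by
  funext x
  simp only [act_apply, Matrix.smul_apply, Pi.smul_apply, smul_eq_mul]
  exact Finset.sum_congr rfl fun y _ => by ring

theorem act_unit_apply {r a b c : ℕ} (A : Matrix (Fin a) (Fin r) K)
    (B : Matrix (Fin b) (Fin r) K) (C : Matrix (Fin c) (Fin r) K) (x : Fin a × Fin b × Fin c) :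
    act A B C (unit K r) x = ∑ i, A x.1 i * B x.2.1 i * C x.2.2 i := by
  simp [act, unit, ite_and]

theorem Restricts.trans {a b c a' b' c' a'' b'' c'' : ℕ} {S : Tensor3 K a'' b'' c''}
    {T : Tensor3 K a' b' c'} {U : Tensor3 K a b c} (h : Restricts S T) (h' : Restricts T U) :
    Restricts S U := by
  obtain ⟨A, B, C, rfl⟩ := h
  obtain ⟨A', B', C', rfl⟩ := h'
  exact ⟨_, _, _, act_act ..⟩

theorem unit_restricts_unit {r q : ℕ} (h : r ≤ q) : Restricts (unit K r) (unit K q) := by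
  let E : Matrix (Fin r) (Fin q) K := Matrix.of fun i j => if Fin.castLE h i = j then 1 else 0
  refine ⟨E, E, E, funext fun ⟨i, j, k⟩ => ?_⟩
  rw [act_unit_apply]
  simp only [unit, E, Matrix.of_apply, ite_mul, one_mul, zero_mul, Finset.sum_ite_eq,
    Finset.mem_univ, if_true, Fin.castLE_inj, ite_and]
  grind

theorem le_subrank_iff {a b c r : ℕ} {T : Tensor3 K a b c} :
    r ≤ subrank T ↔ Restricts (unit K r) T :=
  ⟨fun h => (unit_restricts_unit h).trans (isGreatest_subrank T).1,
    fun h => (isGreatest_subrank T).2 h⟩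

/-- Contracting one leg of `I_r` with the coefficients `g` of a row relation gives zero, while its
entry at `(l, l)` is `g l`. -/
theorem linearIndependent_of_unit_eq_act {a b c r : ℕ} {A : Matrix (Fin r) (Fin a) K}
    {B : Matrix (Fin r) (Fin b) K} {C : Matrix (Fin r) (Fin c) K} {T : Tensor3 K a b c}
    (h : unit K r = act A B C T) :
    LinearIndependent K A.row ∧ LinearIndependent K B.row ∧ LinearIndependent K C.row := by
  have hrow {m : ℕ} {M : Matrix (Fin r) (Fin m) K} {g : Fin r → K}
      (hg : ∑ i, g i • M.row i = 0) : (Matrix.of fun _ : Fin 1 => g) * M = 0 := by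
    ext i p
    simpa [Matrix.mul_apply] using congrFun hg p
  refine ⟨?_, ?_, ?_⟩ <;> rw [Fintype.linearIndependent_iff] <;> intro g hg l
  · have h1 := congrFun (congrArg (act (Matrix.of fun _ : Fin 1 => g) 1 1) h) (0, l, l)
    rw [act_act, hrow hg, act_unit_apply] at h1
    simpa [act_apply, Matrix.one_apply] using h1
  · have h1 := congrFun (congrArg (act 1 (Matrix.of fun _ : Fin 1 => g) 1) h) (l, 0, l)
    rw [act_act, hrow hg, act_unit_apply] at h1
    simpa [act_apply, Matrix.one_apply] using h1
  · have h1 := congrFun (congrArg (act 1 1 (Matrix.of fun _ : Fin 1 => g)) h) (l, l, 0)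
    rw [act_act, hrow hg, act_unit_apply] at h1
    simpa [act_apply, Matrix.one_apply] using h1

end Restriction

end Tensor3

/-! ### Completing independent rows to normalized invertible matrices. -/

section Pivots

variable {K : Type*} [Field K]

theorem LinearIndependent.exists_extend_standard {n r : ℕ} (hr : r ≤ n) {A : Fin r → Fin n → K}
    (hA : LinearIndependent K A) :
    ∃ g : Fin n → Fin n → K, LinearIndependent K g ∧ (∀ i, g (Fin.castLE hr i) = A i) ∧
      ∀ i : Fin n, r ≤ i.val → ∃ j, g i = Pi.single j 1 := by
  suffices h : ∀ m, (hm : r ≤ m) → m ≤ n → ∃ g : Fin m → Fin n → K, LinearIndependent K g ∧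
      (∀ i, g (Fin.castLE hm i) = A i) ∧ ∀ i : Fin m, r ≤ i.val → ∃ j, g i = Pi.single j 1 from
    h n hr le_rfl
  intro m hm
  induction m, hm using Nat.le_induction with
  | base =>
    exact fun _ => ⟨A, hA, fun i => rfl, fun i hi => absurd i.isLt (by omega)⟩
  | succ m hm ih =>
    intro hmn
    obtain ⟨g, hg, hgA, hgs⟩ := ih (by omega)
    -- Fewer than `n` vectors cannot span, so some standard basis vector lies outside their span.
    obtain ⟨j, hj⟩ : ∃ j, (Pi.single j 1 : Fin n → K) ∉ Submodule.span K (Set.range g) := by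
      by_contra! hall
      have htop : Submodule.span K (Set.range g) = ⊤ := by
        rw [eq_top_iff, ← (Pi.basisFun K (Fin n)).span_eq, Submodule.span_le]
        rintro _ ⟨j, rfl⟩
        simpa using hall j
      have h1 := finrank_span_eq_card hg
      rw [htop, finrank_top] at h1
      simp at h1
      omega
    refine ⟨Fin.snoc g (Pi.single j 1), linearIndependent_finSnoc.2 ⟨hg, hj⟩, fun i => ?_,
      fun i => ?_⟩
    · rw [← hgA i]
      exact Fin.snoc_castSucc (α := fun _ => Fin n → K) (Pi.single j 1) g (Fin.castLE hm i)
    · refine Fin.lastCases (fun _ => ⟨j, by simp⟩) (fun i hi => ?_) i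
      simpa using hgs i hi

/-- The rows of index less than `r` of `g` are `1` at the pivots `c`, and the other rows are the
standard basis vectors at `c`. -/
def Matrix.IsPivoted {n : ℕ} (r : ℕ) (c : Fin n → Fin n) (g : Matrix (Fin n) (Fin n) K) : Prop :=
  (∀ i, g i (c i) = 1) ∧ ∀ i j, r ≤ i.val → j ≠ c i → g i j = 0

/-- Scaling each row to have a 1 at a nonzero entry saves one parameter per row; these savings are
needed for the sharp count. -/
theorem LinearIndependent.exists_isPivoted {n r : ℕ} (hr : r ≤ n) {A : Fin r → Fin n → K}
    (hA : LinearIndependent K A) :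
    ∃ (g : Matrix (Fin n) (Fin n) K) (c : Fin n → Fin n) (d : Fin r → K), IsUnit g.det ∧
      g.IsPivoted r c ∧ (∀ i, d i ≠ 0) ∧ ∀ i j, g (Fin.castLE hr i) j = d i * A i j := by
  have h0 : ∀ i, ∃ j, A i j ≠ 0 := fun i => Function.ne_iff.1 (hA.ne_zero i)
  choose p hp using h0
  have hA' : LinearIndependent K fun i => (A i (p i))⁻¹ • A i :=
    hA.units_smul fun i => Units.mk0 _ (inv_ne_zero (hp i))
  obtain ⟨g, hg, hgA, hgs⟩ := hA'.exists_extend_standard hr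
  choose s hs using hgs
  refine ⟨Matrix.of g, fun i => if h : i.val < r then p ⟨i, h⟩ else s i (not_lt.1 h),
    fun i => (A i (p i))⁻¹, ?_, ⟨fun i => ?_, fun i j hi hj => ?_⟩,
    fun i => inv_ne_zero (hp i), fun i j => ?_⟩
  · rw [← Matrix.isUnit_iff_isUnit_det]
    exact Matrix.linearIndependent_rows_iff_isUnit.1 hg
  · by_cases h : i.val < r
    · have h1 := congrFun (hgA ⟨i, h⟩) (p ⟨i, h⟩)
      simp only [Fin.castLE_mk, Pi.smul_apply, smul_eq_mul, Fin.eta,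
        inv_mul_cancel₀ (hp ⟨i, h⟩)] at h1
      simpa [h] using h1
    · simp [h, hs i (not_lt.1 h)]
  · have h : ¬ i.val < r := not_lt.2 hi
    simp only [h, dite_false] at hj
    simp [hs i hi, hj]
  · simpa using congrFun (hgA i) j

end Pivots

/-! ### The orbit description of `C_r`. -/

namespace Tensor3

section Orbit

variable {K : Type*} [Field K] {n r : ℕ}

/-- The row scalings turn the leading block `I_r` into a diagonal block with nonzero entries `dA i *
dB i * dC i`, which is why `X_r` leaves the diagonal values free. -/
theorem exists_isPivoted_act_mem_diagonalBlock (hr : r ≤ n) {T : Tensor3 K n n n}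
    (hT : Restricts (unit K r) T) :
    ∃ (cA cB cC : Fin n → Fin n) (gA gB gC : Matrix (Fin n) (Fin n) K),
      (IsUnit gA.det ∧ IsUnit gB.det ∧ IsUnit gC.det) ∧
      (gA.IsPivoted r cA ∧ gB.IsPivoted r cB ∧ gC.IsPivoted r cC) ∧
      act gA gB gC T ∈ diagonalBlock K n r := by
  obtain ⟨A, B, C, h⟩ := hT
  obtain ⟨hA, hB, hC⟩ := linearIndependent_of_unit_eq_act h
  obtain ⟨gA, cA, dA, huA, hpA, hdA, hA⟩ := hA.exists_isPivoted hr
  obtain ⟨gB, cB, dB, huB, hpB, hdB, hB⟩ := hB.exists_isPivoted hr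
  obtain ⟨gC, cC, dC, huC, hpC, hdC, hC⟩ := hC.exists_isPivoted hr
  have key (i j k : Fin r) : act gA gB gC T (Fin.castLE hr i, Fin.castLE hr j, Fin.castLE hr k) =
      dA i * dB j * dC k * unit K r (i, j, k) := by
    rw [h, act_apply, act_apply, Finset.mul_sum]
    refine Finset.sum_congr rfl fun y _ => ?_
    simp only [hA, hB, hC, Matrix.row]
    ring
  refine ⟨cA, cB, cC, gA, gB, gC, ⟨huA, huB, huC⟩, ⟨hpA, hpB, hpC⟩, fun i j k hi hj hk hne => ?_,
    fun i hi => ?_⟩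
  · have h1 := key ⟨i, hi⟩ ⟨j, hj⟩ ⟨k, hk⟩
    have h2 : unit K r (⟨i, hi⟩, ⟨j, hj⟩, ⟨k, hk⟩) = 0 :=
      if_neg fun h => hne (by simpa [Fin.ext_iff] using h)
    simpa [h2] using h1
  · have h1 := key ⟨i, hi⟩ ⟨i, hi⟩ ⟨i, hi⟩
    simp only [Fin.castLE_mk, Fin.eta] at h1
    rw [h1]
    simp [unit, hdA, hdB, hdC]

theorem unit_restricts_of_mem_diagonalBlock (hr : r ≤ n) {T : Tensor3 K n n n}
    (hT : T ∈ diagonalBlock K n r) : Restricts (unit K r) T := by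
  let P : Matrix (Fin r) (Fin n) K := Matrix.of fun i j => if Fin.castLE hr i = j then 1 else 0
  -- One leg suffices to normalize the diagonal entries to 1.
  let D : Matrix (Fin r) (Fin n) K :=
    Matrix.of fun i j => if Fin.castLE hr i = j then (T (j, j, j))⁻¹ else 0
  refine ⟨D, P, P, funext fun ⟨i, j, k⟩ => ?_⟩
  have h1 : act D P P T (i, j, k) = (T (Fin.castLE hr i, Fin.castLE hr i, Fin.castLE hr i))⁻¹ *
      T (Fin.castLE hr i, Fin.castLE hr j, Fin.castLE hr k) := by
    simp [act, D, P, ite_mul]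
  rw [h1]
  by_cases h : i = j ∧ j = k
  · obtain ⟨rfl, rfl⟩ := h
    simp [unit, hT.2 (Fin.castLE hr i) i.isLt]
  · rw [hT.1 (Fin.castLE hr i) (Fin.castLE hr j) (Fin.castLE hr k) i.isLt j.isLt k.isLt
      (by simpa only [Fin.castLE_inj] using h), mul_zero]
    exact if_neg h

theorem eq_act_nonsing_inv {gA gB gC : Matrix (Fin n) (Fin n) K} (hA : IsUnit gA.det)
    (hB : IsUnit gB.det) (hC : IsUnit gC.det) (T : Tensor3 K n n n) :
    T = act gA⁻¹ gB⁻¹ gC⁻¹ (act gA gB gC T) := by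
  rw [act_act, Matrix.nonsing_inv_mul _ hA, Matrix.nonsing_inv_mul _ hB,
    Matrix.nonsing_inv_mul _ hC, act_one]

theorem subrankGE_eq_orbit_diagonalBlock (hr : r ≤ n) :
    subrankGE K n r = orbit (diagonalBlock K n r) := by
  ext T
  constructor
  · intro hT
    obtain ⟨_, _, _, gA, gB, gC, ⟨hA, hB, hC⟩, -, hmem⟩ :=
      exists_isPivoted_act_mem_diagonalBlock hr (le_subrank_iff.1 hT)
    refine ⟨(Matrix.GeneralLinearGroup.mk'' gA hA)⁻¹, (Matrix.GeneralLinearGroup.mk'' gB hB)⁻¹,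
      (Matrix.GeneralLinearGroup.mk'' gC hC)⁻¹, _, hmem, ?_⟩
    simp only [Matrix.coe_units_inv]
    exact eq_act_nonsing_inv hA hB hC T
  · rintro ⟨A, B, C, T', hT', rfl⟩
    refine le_subrank_iff.2 ((unit_restricts_of_mem_diagonalBlock hr hT').trans
      ⟨(A⁻¹ : Matrix.GeneralLinearGroup (Fin n) K), (B⁻¹ : Matrix.GeneralLinearGroup (Fin n) K),
        (C⁻¹ : Matrix.GeneralLinearGroup (Fin n) K), ?_⟩)
    rw [act_act, ← Units.val_mul, ← Units.val_mul, ← Units.val_mul]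
    simp [act_one]

end Orbit

end Tensor3

/-! ### Parameter count and the dimension bound. -/

section Parametrization

open MvPolynomial

/-- The free positions of a matrix that is pivoted at `c`. -/
abbrev FreeEntry {n : ℕ} (r : ℕ) (c : Fin n → Fin n) : Type :=
  {p : Fin n × Fin n // p.1.val < r ∧ p.2 ≠ c p.1}

/-- The positions off the diagonal of the leading `r × r × r` block. -/
abbrev OffDiagonal (n r : ℕ) (x : Fin n × Fin n × Fin n) : Prop :=
  (x.1.val < r ∧ x.2.1.val < r ∧ x.2.2.val < r) ∧ ¬(x.1 = x.2.1 ∧ x.2.1 = x.2.2)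

theorem card_freeEntry {n r : ℕ} (hr : r ≤ n) (c : Fin n → Fin n) :
    Fintype.card (FreeEntry r c) = r * (n - 1) := by
  let e : FreeEntry r c ≃ Σ i : {i : Fin n // i.val < r}, {j // j ≠ c i} :=
    { toFun := fun p => ⟨⟨p.1.1, p.2.1⟩, ⟨p.1.2, p.2.2⟩⟩
      invFun := fun q => ⟨(q.1.1, q.2.1), q.1.2, q.2.2⟩
      left_inv := fun _ => rfl
      right_inv := fun _ => rfl }
  have h : Fintype.card {i : Fin n // i.val < r} = r := by
    rw [Fintype.card_congr (Fin.castLEquiv hr).symm, Fintype.card_fin]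
  rw [Fintype.card_congr e, Fintype.card_sigma]
  simp [Fintype.card_subtype_compl, h]

theorem card_not_offDiagonal_le {n r : ℕ} (hr : r ≤ n) :
    Fintype.card {x // ¬ OffDiagonal n r x} + r ^ 3 ≤ n ^ 3 + r := by
  let D : Fin r × Fin r × Fin r → Prop := fun x => x.1 = x.2.1 ∧ x.2.1 = x.2.2
  have h1 : Fintype.card {x // ¬ D x} ≤ Fintype.card {x // OffDiagonal n r x} := by
    refine Fintype.card_le_of_injective (fun x => ⟨(Fin.castLE hr x.1.1, Fin.castLE hr x.1.2.1,
      Fin.castLE hr x.1.2.2), ⟨x.1.1.isLt, x.1.2.1.isLt, x.1.2.2.isLt⟩, ?_⟩) ?_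
    · simpa [D] using x.2
    · rintro ⟨⟨i, j, k⟩, h⟩ ⟨⟨i', j', k'⟩, h'⟩ heq
      simpa using heq
  have h2 : Fintype.card {x // D x} ≤ r := by
    refine (Fintype.card_le_of_injective (fun x : {x // D x} => x.1.1) ?_).trans
      (Fintype.card_fin r).le
    rintro ⟨⟨i, j, k⟩, h, h'⟩ ⟨⟨i', j', k'⟩, g, g'⟩ heq
    simp only at h h' g g' heq
    subst h h' heq g g'
    rfl
  have h3 := Fintype.card_subtype_compl D
  have h4 := Fintype.card_subtype_compl (OffDiagonal n r)
  have h5 := Fintype.card_subtype_le (OffDiagonal n r)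
  simp only [Fintype.card_prod, Fintype.card_fin] at h3 h4 h5
  have h6 : r ^ 3 = r * (r * r) := by ring
  have h7 : n ^ 3 = n * (n * n) := by ring
  omega

/-- The matrix pivoted at `c` with prescribed free entries. -/
def pivotMatrix {R : Type*} [CommRing R] {n r : ℕ} (c : Fin n → Fin n) (y : FreeEntry r c → R) :
    Matrix (Fin n) (Fin n) R :=
  Matrix.of fun i j => if h : i.val < r ∧ j ≠ c i then y ⟨(i, j), h⟩ else if j = c i then 1 else 0

theorem map_pivotMatrix {R S : Type*} [CommRing R] [CommRing S] (f : R →+* S) {n r : ℕ}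
    (c : Fin n → Fin n) (y : FreeEntry r c → R) :
    f.mapMatrix (pivotMatrix c y) = pivotMatrix c fun p => f (y p) := by
  ext i j
  simp only [pivotMatrix, RingHom.mapMatrix_apply, Matrix.map_apply, Matrix.of_apply]
  split_ifs <;> simp

theorem Matrix.IsPivoted.eq_pivotMatrix {K : Type*} [Field K] {n r : ℕ} {c : Fin n → Fin n}
    {g : Matrix (Fin n) (Fin n) K} (hg : g.IsPivoted r c) :
    g = pivotMatrix c fun p : FreeEntry r c => g p.1.1 p.1.2 := by
  ext i j
  simp only [pivotMatrix, Matrix.of_apply]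
  split_ifs with h h'
  · rfl
  · rw [h', hg.1]
  · exact hg.2 i j (by by_contra hi; exact h ⟨not_le.1 hi, h'⟩) h'

namespace Tensor3

/-- The tensor that vanishes off the diagonal of the leading block, with prescribed other
entries. -/
def ofBlock {R : Type*} [CommRing R] {n r : ℕ} (y : {x // ¬ OffDiagonal n r x} → R)
    (x : Fin n × Fin n × Fin n) : R :=
  if h : ¬ OffDiagonal n r x then y ⟨x, h⟩ else 0

/-- Parameters for the tensors whose leading block becomes diagonal after the action of matrices
pivoted at `c.1`, `c.2.1`, `c.2.2`. -/
abbrev PivotParam (n r : ℕ) (c : (Fin n → Fin n) × (Fin n → Fin n) × (Fin n → Fin n)) : Type :=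
  FreeEntry r c.1 ⊕ FreeEntry r c.2.1 ⊕ FreeEntry r c.2.2 ⊕ {x // ¬ OffDiagonal n r x}

/-- The polynomial parametrization of tensors by `PivotParam`. -/
noncomputable def pivotPoly (K : Type*) [Field K] {n : ℕ} (r : ℕ)
    (c : (Fin n → Fin n) × (Fin n → Fin n) × (Fin n → Fin n))
    (x : Fin n × Fin n × Fin n) : MvPolynomial (PivotParam n r c) K :=
  ∑ z : Fin n × Fin n × Fin n,
    (pivotMatrix c.1 fun p => X (Sum.inl p)).adjugate x.1 z.1 *
    (pivotMatrix c.2.1 fun p => X (Sum.inr (Sum.inl p))).adjugate x.2.1 z.2.1 *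
    (pivotMatrix c.2.2 fun p => X (Sum.inr (Sum.inr (Sum.inl p)))).adjugate x.2.2 z.2.2 *
    ofBlock (fun p => X (Sum.inr (Sum.inr (Sum.inr p)))) z

variable {K : Type*} [Field K] {n r : ℕ}

theorem eval_pivotPoly (c : (Fin n → Fin n) × (Fin n → Fin n) × (Fin n → Fin n))
    (yA : FreeEntry r c.1 → K) (yB : FreeEntry r c.2.1 → K) (yC : FreeEntry r c.2.2 → K)
    (yT : {x // ¬ OffDiagonal n r x} → K) (x : Fin n × Fin n × Fin n) :
    eval (Sum.elim yA (Sum.elim yB (Sum.elim yC yT))) (pivotPoly K r c x) =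
      act (pivotMatrix c.1 yA).adjugate (pivotMatrix c.2.1 yB).adjugate
        (pivotMatrix c.2.2 yC).adjugate (ofBlock yT) x := by
  have hadj {τ : Type} (y : τ → K) {d : Fin n → Fin n} (u : FreeEntry r d → MvPolynomial τ K)
      (i j : Fin n) : eval y ((pivotMatrix d u).adjugate i j) =
        (pivotMatrix d fun p => eval y (u p)).adjugate i j := by
    rw [← map_pivotMatrix, ← RingHom.map_adjugate]
    rfl
  rw [act_apply, pivotPoly, map_sum]
  refine Finset.sum_congr rfl fun z _ => ?_
  simp only [map_mul, hadj, eval_X, Sum.elim_inl, Sum.elim_inr]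
  congr 1
  unfold ofBlock
  split_ifs <;> simp

/-- Inverse matrices are not polynomial in the entries, but adjugates are. The inverse determinants
are moved into the tensor, whose off-diagonal zeros survive scaling. -/
theorem exists_eval_pivotPoly_eq (hr : r ≤ n) {T : Tensor3 K n n n}
    (hT : Restricts (unit K r) T) :
    ∃ c, ∃ y : PivotParam n r c → K, ∀ x, eval y (pivotPoly K r c x) = T x := by
  obtain ⟨cA, cB, cC, gA, gB, gC, ⟨hA, hB, hC⟩, ⟨hpA, hpB, hpC⟩, hmem⟩ :=
    exists_isPivoted_act_mem_diagonalBlock hr hT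
  let S : Tensor3 K n n n :=
    (Ring.inverse gA.det * Ring.inverse gB.det * Ring.inverse gC.det) • act gA gB gC T
  have hS : S = ofBlock fun p : {x // ¬ OffDiagonal n r x} => S p.1 := by
    funext x
    unfold ofBlock
    split_ifs with h
    · have h0 := hmem.1 x.1 x.2.1 x.2.2 h.1.1 h.1.2.1 h.1.2.2 h.2
      simp only [S, Pi.smul_apply, h0, smul_zero]
    · rfl
  refine ⟨(cA, cB, cC), Sum.elim (fun p => gA p.1.1 p.1.2) (Sum.elim (fun p => gB p.1.1 p.1.2)
    (Sum.elim (fun p => gC p.1.1 p.1.2) fun p => S p.1)), fun x => ?_⟩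
  rw [eval_pivotPoly, ← hpA.eq_pivotMatrix, ← hpB.eq_pivotMatrix, ← hpC.eq_pivotMatrix, ← hS,
    ← act_smul, ← Matrix.inv_def, ← Matrix.inv_def, ← Matrix.inv_def,
    ← eq_act_nonsing_inv hA hB hC]

theorem subrankGE_eq_empty (h : n < r) : subrankGE K n r = ∅ := by
  ext T
  simp only [subrankGE, Set.mem_ofPred_eq, Set.mem_empty_iff_false, iff_false, not_le]
  exact (le_of_unit_restricts (isGreatest_subrank T).1).trans_lt h

theorem zariskiDim_subrankGE_add_le (hn : 1 ≤ n) (r : ℕ) :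
    zariskiDim (subrankGE K n r) + ((r * (r ^ 2 + 2) : ℕ) : WithBot ℕ∞)
      ≤ ((n ^ 3 + r * (3 * n) : ℕ) : WithBot ℕ∞) := by
  rcases le_or_gt r n with hr | hr
  · have hcard := card_not_offDiagonal_le hr
    have h := zariskiDim_le_of_subset_iUnion_range
      (N := 3 * (r * (n - 1)) + Fintype.card {x // ¬ OffDiagonal n r x})
      (fun c => by simp only [Fintype.card_sum, card_freeEntry hr]; omega)
      (pivotPoly K r) (S := subrankGE K n r)
      fun T hT => exists_eval_pivotPoly_eq hr (le_subrank_iff.1 hT)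
    refine (add_le_add_left h _).trans ?_
    norm_cast
    obtain ⟨m, rfl⟩ := Nat.exists_eq_add_of_le' hn
    -- With `n = m + 1` the count is `3rm + (n³ + r) + 2r = n³ + 3rn`.
    rw [Nat.add_sub_cancel]
    nlinarith [hcard]
  · rw [subrankGE_eq_empty hr, zariskiDim, vanishingIdeal_empty,
      ringKrullDim_eq_bot_of_subsingleton, WithBot.bot_add]
    exact bot_le

/-! ### Existence, uniqueness and size of the generic subrank. -/

/-- The equations `I_r = (A ⊗ B ⊗ C) T` in the entries of `A`, `B`, `C` and `T`. -/
noncomputable def unitEquation (K : Type*) [Field K] (n r : ℕ) (x : Fin r × Fin r × Fin r) :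
    MvPolynomial ((Fin r × Fin n) ⊕ (Fin r × Fin n) ⊕ (Fin r × Fin n) ⊕
      (Fin n × Fin n × Fin n)) K :=
  ∑ y : Fin n × Fin n × Fin n, X (Sum.inl (x.1, y.1)) * X (Sum.inr (Sum.inl (x.2.1, y.2.1))) *
    X (Sum.inr (Sum.inr (Sum.inl (x.2.2, y.2.2)))) * X (Sum.inr (Sum.inr (Sum.inr y))) -
    C (unit K r x)

/-- Exhibits `C_r` as the projection of an incidence variety to the coordinates of `T`, the form to
which Chevalley's theorem applies. -/
theorem image_zeroLocus_unitEquation :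
    (fun y s => eval y (X (Sum.inr (Sum.inr (Sum.inr s))))) ''
      zeroLocus K (Ideal.span (Set.range (unitEquation K n r))) = subrankGE K n r := by
  rw [zeroLocus_span]
  ext T
  refine Iff.trans ?_ le_subrank_iff.symm
  constructor
  · rintro ⟨y, hy, rfl⟩
    refine ⟨Matrix.of fun i j => y (Sum.inl (i, j)),
      Matrix.of fun i j => y (Sum.inr (Sum.inl (i, j))),
      Matrix.of fun i j => y (Sum.inr (Sum.inr (Sum.inl (i, j)))), funext fun x => ?_⟩
    have h := hy _ ⟨x, rfl⟩
    rw [act_apply]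
    refine (sub_eq_zero.1 ?_).symm
    simpa [unitEquation] using h
  · rintro ⟨A, B, C, h⟩
    refine ⟨Sum.elim (fun p => A p.1 p.2) (Sum.elim (fun p => B p.1 p.2)
      (Sum.elim (fun p => C p.1 p.2) T)), ?_, by simp⟩
    rintro _ ⟨x, rfl⟩
    have h := congrFun h x
    rw [act_apply] at h
    simp [unitEquation, h]

theorem exists_ne_zero_subset_subrankGE [IsAlgClosed K]
    (h : vanishingIdeal K (subrankGE K n r) = ⊥) :
    ∃ a : MvPolynomial (Fin n × Fin n × Fin n) K, a ≠ 0 ∧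
      {x | eval x a ≠ 0} ⊆ subrankGE K n r := by
  rw [← image_zeroLocus_unitEquation] at h ⊢
  exact exists_ne_zero_subset_image_zeroLocus _ _ h

theorem exists_isGenericSubrank (K : Type*) [Field K] [IsAlgClosed K] (n : ℕ) :
    ∃ q, IsGenericSubrank K n q := by
  classical
  let P : ℕ → Prop := fun r => vanishingIdeal K (subrankGE K n r) = ⊥
  have hP0 : P 0 := vanishingIdeal_eq_bot_of_ne_zero_subset (a := 1) one_ne_zero
    fun _ _ => Nat.zero_le _
  have hPq : P (Nat.findGreatest P n) := Nat.findGreatest_spec (Nat.zero_le n) hP0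
  obtain ⟨p, hp, hp0⟩ : ∃ p ∈ vanishingIdeal K (subrankGE K n (Nat.findGreatest P n + 1)),
      p ≠ 0 := by
    refine Submodule.exists_mem_ne_zero_of_ne_bot fun h => ?_
    -- The search for the maximum stops at `n`; beyond it the set is empty and its vanishing ideal
    -- is everything.
    by_cases hq : Nat.findGreatest P n + 1 ≤ n
    · exact Nat.findGreatest_is_greatest (Nat.lt_succ_self _) hq h
    · rw [subrankGE_eq_empty (not_le.1 hq), vanishingIdeal_empty] at h
      exact top_ne_bot h
  obtain ⟨a, ha0, ha⟩ := exists_ne_zero_subset_subrankGE hPq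
  refine ⟨Nat.findGreatest P n, _, isZariskiOpen_ne_zero (a * p), ?_, fun T hT => ?_⟩
  · by_contra hne
    refine mul_ne_zero ha0 hp0 (MvPolynomial.funext fun x => ?_)
    by_contra hx
    exact hne ⟨x, by simpa using hx⟩
  · have hT' : eval T a ≠ 0 ∧ eval T p ≠ 0 := by simpa using hT
    refine le_antisymm ?_ (ha hT'.1)
    by_contra! hlt
    exact hT'.2 (hp T hlt)

end Tensor3

theorem IsGenericSubrank.eq {K : Type*} [Field K] [Infinite K] {n q q' : ℕ}
    (h : IsGenericSubrank K n q) (h' : IsGenericSubrank K n q') : q = q' := by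
  obtain ⟨U, hU, hne, hq⟩ := h
  obtain ⟨U', hU', hne', hq'⟩ := h'
  obtain ⟨a, ha, haU⟩ := hU.exists_ne_zero_subset hne
  obtain ⟨a', ha', haU'⟩ := hU'.exists_ne_zero_subset hne'
  by_contra hqq
  refine mul_ne_zero ha ha' (MvPolynomial.funext fun x => ?_)
  by_contra hx
  have hx' : eval x a ≠ 0 ∧ eval x a' ≠ 0 := by simpa using hx
  exact hqq ((hq x (haU hx'.1)).symm.trans (hq' x (haU' hx'.2)))

theorem IsGenericSubrank.sq_add_two_le {K : Type*} [Field K] [Infinite K] {n q : ℕ} (hn : 1 ≤ n)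
    (h : IsGenericSubrank K n q) (hq : q ≠ 0) : q ^ 2 + 2 ≤ 3 * n := by
  obtain ⟨U, hU, hne, hUq⟩ := h
  obtain ⟨a, ha, haU⟩ := hU.exists_ne_zero_subset hne
  have hbot := vanishingIdeal_eq_bot_of_ne_zero_subset ha
    (haU.trans fun T hT => (hUq T hT).ge : _ ⊆ Tensor3.subrankGE K n q)
  have hdim := Tensor3.zariskiDim_subrankGE_add_le (K := K) hn q
  rw [zariskiDim_of_vanishingIdeal_eq_bot hbot] at hdim
  simp only [Fintype.card_prod, Fintype.card_fin] at hdim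
  norm_cast at hdim
  -- Density makes the dimension `n³`, so the bound reads `q(q² + 2) ≤ 3nq`; cancelling requires `q
  -- ≠ 0`.
  refine le_of_mul_le_mul_left (a := q) ?_ (Nat.pos_of_ne_zero hq)
  have h7 : n ^ 3 = n * (n * n) := by ring
  omega

end Parametrization

theorem theorem1p2 (K : Type*) [Field K] [IsAlgClosed K] (n : ℕ) (hn : 1 ≤ n) :
    -- the generic subrank `Q(n)` exists and is unique
    (∃! q : ℕ, IsGenericSubrank K n q) ∧
    -- it is at most `⌊√(3n-2)⌋`
    (∀ q : ℕ, IsGenericSubrank K n q → q ≤ ⌊√(3 * (n : ℝ) - 2)⌋₊) ∧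
    -- `C_r` is the `GL_n × GL_n × GL_n`-orbit of `X_r`
    (∀ r : ℕ, r ≤ n →
      Tensor3.subrankGE K n r = Tensor3.orbit (Tensor3.diagonalBlock K n r)) ∧
    -- `dim C_r ≤ n³ - r(r² - 3n + 2)`, with the negative terms moved to the other side
    (∀ r : ℕ, zariskiDim (Tensor3.subrankGE K n r) + ((r * (r ^ 2 + 2) : ℕ) : WithBot ℕ∞)
      ≤ ((n ^ 3 + r * (3 * n) : ℕ) : WithBot ℕ∞)) := by
  have := IsAlgClosed.instInfinite (K := K)
  refine ⟨?_, fun q hq => ?_, fun r hr => Tensor3.subrankGE_eq_orbit_diagonalBlock hr,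
    Tensor3.zariskiDim_subrankGE_add_le hn⟩
  · obtain ⟨q, hq⟩ := Tensor3.exists_isGenericSubrank K n
    exact ⟨q, hq, fun q' hq' => hq'.eq hq⟩
  · rcases eq_or_ne q 0 with rfl | h0
    · exact Nat.zero_le _
    · have h : ((q ^ 2 + 2 : ℕ) : ℝ) ≤ ((3 * n : ℕ) : ℝ) := by
        exact_mod_cast hq.sq_add_two_le hn h0
      push_cast at h
      exact Nat.le_floor (Real.le_sqrt_of_sq_le (by linarith))
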